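/- Let $R$ be a ring (associative, with unit, not necessarily commutative) and let $R\text{-Mod}$ be the category of left $R$-modules. A left $R$-module is Gorenstein projective if it is a syzygy $\ker(P_n\to P_{n-1})$ of an exact complex $\mathbf P=(\cdots\to P_1\to P_0\to P_{-1}\to\cdots)$ of projective modules such that $\operatorname{Hom}_R(\mathbf P,Q)$ is exact for every projective module $Q$. It is Gorenstein injective if it is a syzygy $\ker(I_n\to I_{n-1})$ of an exact complex $\mathbf I$ of injective modules such that $\operatorname{Hom}_R(J,\mathbf I)$ is exact for every injective module $J$. The Gorenstein projective dimension $\mathcal G\mathrm{pd}\,M\in\mathbb N\cup\{\infty\}$ is defined inductively: $\mathcal G\mathrm{pd}\,M\le 0$ if $M$ is Gorenstein projective, and $\mathcal G\mathrm{pd}\,M\le n+1$ if there is a short exact sequence $0\to K\to G\to M\to 0$ with $G$ Gorenstein projective and $\mathcal G\mathrm{pd}\,K\le n$. The Gorenstein injective dimension $\mathcal G\mathrm{id}\,M$ is defined dually, with short exact sequences $0\to M\to G\to L\to 0$. Put $$\operatorname{spli}R=\sup\{\operatorname{pd}I \mid I \text{ an injective left } R\text{-module}\},\qquad \operatorname{silp}R=\sup\{\operatorname{id}P\mid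 P\text{ a projective left } R\text{-module}\}.$$ Then for every integer $m\ge 0$ the following are equivalent: 1. $\sup\{\mathcal G\mathrm{pd}\,M\mid M\in R\text{-Mod}\}\le m$; 2. $\sup\{\mathcal G\mathrm{id}\,M\mid M\in R\text{-Mod}\}\le m$; 3. $\operatorname{spli}R=\operatorname{silp}R\le m$. Moreover, $\sup\{\mathcal G\mathrm{pd}\,M\mid M\in R\text{-Mod}\}=\sup\{\mathcal G\mathrm{id}\,M\mid M\in R\text{-Mod}\}$ (as elements of $\mathbb N\cup\{\infty\}$). -/

import Mathlib

open CategoryTheory CategoryTheory.Limits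

universe v u

namespace Gorenstein

section Definitions

variable {C : Type u} [Category.{v} C] [Abelian C]

/-- A complete projective resolution: an exact complex
`⋯ ⟶ P₁ ⟶ P₀ ⟶ P₋₁ ⟶ ⋯` of projective objects such that the complex of abelian groups
`Hom(P, Q)` is exact for every projective object `Q`.  (Exactness of `Hom(P, Q)` at `Hom(Pₙ, Q)`
says that every morphism `Pₙ ⟶ Q` that vanishes on the image of `Pₙ₊₁` factors
through the differential `Pₙ ⟶ Pₙ₋₁`.) -/
structure IsCompleteProjectiveResolution (P : ChainComplex C ℤ) : Prop where
  projective : ∀ n : ℤ, Projective (P.X n)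
  acyclic : P.Acyclic
  hom_exact : ∀ (Q : C), Projective Q → ∀ (n : ℤ) (f : P.X n ⟶ Q),
    P.d (n + 1) n ≫ f = 0 → ∃ g : P.X (n - 1) ⟶ Q, P.d n (n - 1) ≫ g = f

/-- A complete injective coresolution: an exact complex
`⋯ ⟶ I₁ ⟶ I₀ ⟶ I₋₁ ⟶ ⋯` of injective objects such that the complex of abelian groups
`Hom(J, I)` is exact for every injective object `J`. -/
structure IsCompleteInjectiveCoresolution (I : ChainComplex C ℤ) : Prop where
  injective : ∀ n : ℤ, Injective (I.X n)
  acyclic : I.Acyclic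
  hom_exact : ∀ (J : C), Injective J → ∀ (n : ℤ) (f : J ⟶ I.X n),
    f ≫ I.d n (n - 1) = 0 → ∃ g : J ⟶ I.X (n + 1), g ≫ I.d (n + 1) n = f

/-- An object is Gorenstein projective if it is a syzygy `ker(Pₙ ⟶ Pₙ₋₁)` of a complete
projective resolution. -/
def IsGorensteinProjective (X : C) : Prop :=
  ∃ P : ChainComplex C ℤ, IsCompleteProjectiveResolution P ∧
    ∃ n : ℤ, Nonempty (X ≅ kernel (P.d n (n - 1)))

/-- An object is Gorenstein injective if it is a syzygy `ker(Iₙ ⟶ Iₙ₋₁)` of a complete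
injective coresolution. -/
def IsGorensteinInjective (X : C) : Prop :=
  ∃ I : ChainComplex C ℤ, IsCompleteInjectiveCoresolution I ∧
    ∃ n : ℤ, Nonempty (X ≅ kernel (I.d n (n - 1)))

/-- `HasGorensteinProjectiveDimLE n X` says that the Gorenstein projective dimension of `X` is at
most `n`: for `n = 0` this means that `X` is Gorenstein projective, and for `n + 1` that there is
a short exact sequence `0 ⟶ K ⟶ G ⟶ X ⟶ 0` with `G` Gorenstein projective and
`K` of Gorenstein projective dimension at most `n`. -/
def HasGorensteinProjectiveDimLE : ℕ → C → Prop
  | 0, X => IsGorensteinProjective X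
  | n + 1, X => ∃ S : ShortComplex C, S.ShortExact ∧ Nonempty (S.X₃ ≅ X) ∧
      IsGorensteinProjective S.X₂ ∧ HasGorensteinProjectiveDimLE n S.X₁

/-- `HasGorensteinInjectiveDimLE n X` says that the Gorenstein injective dimension of `X` is at
most `n`: for `n = 0` this means that `X` is Gorenstein injective, and for `n + 1` that there is
a short exact sequence `0 ⟶ X ⟶ G ⟶ L ⟶ 0` with `G` Gorenstein injective and
`L` of Gorenstein injective dimension at most `n`. -/
def HasGorensteinInjectiveDimLE : ℕ → C → Prop
  | 0, X => IsGorensteinInjective X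
  | n + 1, X => ∃ S : ShortComplex C, S.ShortExact ∧ Nonempty (S.X₁ ≅ X) ∧
      IsGorensteinInjective S.X₂ ∧ HasGorensteinInjectiveDimLE n S.X₃

/-- The Gorenstein projective dimension of `X`, the least `n` such that
`HasGorensteinProjectiveDimLE n X`, and `⊤` if there is none. -/
noncomputable def gorensteinProjectiveDim (X : C) : ℕ∞ :=
  ⨅ (n : ℕ) (_ : HasGorensteinProjectiveDimLE n X), (n : ℕ∞)

/-- The Gorenstein injective dimension of `X`, the least `n` such that
`HasGorensteinInjectiveDimLE n X`, and `⊤` if there is none. -/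
noncomputable def gorensteinInjectiveDim (X : C) : ℕ∞ :=
  ⨅ (n : ℕ) (_ : HasGorensteinInjectiveDimLE n X), (n : ℕ∞)

end Definitions

section Global

variable (C : Type u) [Category.{v} C] [Abelian C]

/-- The global Gorenstein projective dimension, `sup {Gpd M | M ∈ C}`. -/
noncomputable def globalGorensteinProjectiveDim : ℕ∞ :=
  ⨆ M : C, gorensteinProjectiveDim M

/-- The global Gorenstein injective dimension, `sup {Gid M | M ∈ C}`. -/
noncomputable def globalGorensteinInjectiveDim : ℕ∞ :=
  ⨆ M : C, gorensteinInjectiveDim M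

/-- `spli`, the supremum of the projective dimensions of the injective objects. -/
noncomputable def spli : WithBot ℕ∞ :=
  ⨆ (I : C) (_ : Injective I), projectiveDimension I

/-- `silp`, the supremum of the injective dimensions of the projective objects. -/
noncomputable def silp : WithBot ℕ∞ :=
  ⨆ (P : C) (_ : Projective P), injectiveDimension P

end Global

end Gorenstein

/-!
The argument works in an abelian category `C` with enough projective and enough injective objects:
`Gpd X ≤ m` for all `X` if and only if `spli C ≤ m` and `silp C ≤ m`
(`globalGorensteinProjectiveDim_le_iff`). This condition is self-dual, so applying the equivalence
to `Cᵒᵖ` gives the same characterization of `Gid X ≤ m` for all `X`.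

Suppose `Gpd X ≤ m` for all `X`. Dimension shifting gives `Extⁱ(X, Q) = 0` for `i > m` and `Q`
projective, so `silp C ≤ m`. Moreover, an object of Gorenstein projective dimension at most `m`
embeds into one of projective dimension at most `m`
(`HasGorensteinProjectiveDimLE.exists_embedding`); for an injective object the embedding splits, so
`spli C ≤ m`.

Conversely, suppose `spli C ≤ m` and `silp C ≤ m`. Embed `X` into an injective object `I` with
cokernel `X'`. By the horseshoe lemma, an `m`-th syzygy of `X` embeds into an `m`-th syzygy of `I`,
which is projective, with an `m`-th syzygy of `X'` as cokernel. Hence the class of all `m`-th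
syzygies supports resolutions by projective objects that are unbounded in both directions; they are
`Hom(-, Q)`-exact because `Ext¹` of an `m`-th syzygy into a projective object vanishes. So all
`m`-th syzygies are Gorenstein projective (`IsProjectiveSyzygy.isGorensteinProjective`).

Finally, if `pd I = k` is finite, `Extᵏ(I, -)` is right exact and nonzero, hence nonzero on some projective object, so `k ≤ silp C`. This and its dual give `spli C = silp C` once both are
finite (`spli_le_silp`, `silp_le_spli`).

Complete resolutions are handled through `HasTwoSidedResolution`, which asks for a class of objects
closed under taking one step of a resolution in either direction. It is compatible with passing to
the opposite category without any reindexing of complexes.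
-/

namespace Gorenstein

open Abelian ZeroObject Opposite

universe w

/-! ### Short exact sequences -/

section ShortExactSequences

variable {C : Type u} [Category.{v} C] [Abelian C]

lemma shortExact_of_iso_left {S : ShortComplex C} (hS : S.ShortExact) {Y : C} (e : S.X₁ ≅ Y) :
    (ShortComplex.mk (e.inv ≫ S.f) S.g (by simp)).ShortExact :=
  ShortComplex.shortExact_of_iso
    (ShortComplex.isoMk e (Iso.refl _) (Iso.refl _) (by simp) (by simp)) hS

lemma shortExact_of_iso_right {S : ShortComplex C} (hS : S.ShortExact) {Y : C} (e : S.X₃ ≅ Y) :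
    (ShortComplex.mk S.f (S.g ≫ e.hom) (by simp)).ShortExact :=
  ShortComplex.shortExact_of_iso
    (S₁ := S) (ShortComplex.isoMk (Iso.refl _) (Iso.refl _) e (by simp) (by simp)) hS

lemma shortExact_cokernel {X Y : C} (f : X ⟶ Y) [Mono f] :
    (ShortComplex.mk f (cokernel.π f) (cokernel.condition f)).ShortExact :=
  .mk' (ShortComplex.exact_cokernel f) inferInstance inferInstance

lemma shortExact_kernel {X Y : C} (g : X ⟶ Y) [Epi g] :
    (ShortComplex.mk (kernel.ι g) g (kernel.condition g)).ShortExact :=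
  .mk' (ShortComplex.exact_kernel g) inferInstance inferInstance

lemma shortExact_biprod (X Y : C) :
    (ShortComplex.mk (biprod.inl : X ⟶ X ⊞ Y) biprod.snd (by simp)).ShortExact :=
  (ShortComplex.Splitting.ofHasBinaryBiproduct X Y).shortExact

/-- The pushout of a monomorphism is a monomorphism with the same cokernel. -/
lemma shortExact_of_isPushout {X₁ X₂ X₃ X₄ D : C} {t : X₁ ⟶ X₂} {l : X₁ ⟶ X₃} {r : X₂ ⟶ X₄}
    {b : X₃ ⟶ X₄} (sq : IsPushout t l r b) {p : X₂ ⟶ D} (w : t ≫ p = 0)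
    (h : (ShortComplex.mk t p w).ShortExact) :
    (ShortComplex.mk b (sq.desc p 0 (by simpa using w)) (by simp)).ShortExact := by
  have hm : Mono t := h.mono_f
  have hp : Epi p := h.epi_g
  have : Mono b := (MorphismProperty.monomorphisms C).of_isPushout sq.flip hm
  have : Epi (sq.desc p 0 (by simpa using w)) := epi_of_epi_fac (sq.inl_desc p 0 _)
  refine .mk' (ShortComplex.exact_of_g_is_cokernel _ ?_) inferInstance inferInstance
  refine CokernelCofork.IsColimit.ofπ _ _
    (fun {Z} k hk ↦ h.gIsCokernel.desc (CokernelCofork.ofπ (r ≫ k) ?_)) ?_ ?_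
  · dsimp
    rw [sq.w_assoc, hk, comp_zero]
  · intro Z k hk
    apply sq.hom_ext
    · rw [IsPushout.inl_desc_assoc]
      exact h.gIsCokernel.fac (CokernelCofork.ofπ (r ≫ k) _) WalkingParallelPair.one
    · simp [hk]
  · intro Z k hk m hm
    rw [← cancel_epi (sq.desc p 0 _), hm]
    apply sq.hom_ext
    · rw [IsPushout.inl_desc_assoc]
      exact (h.gIsCokernel.fac (CokernelCofork.ofπ (r ≫ k) _) WalkingParallelPair.one).symm
    · simp [hk]

/-- The cokernels of a morphism of short exact sequences with monomorphic outer components form a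
short exact sequence; the outer cokernels may be chosen at will. -/
lemma exists_shortExact_cokernels {S T : ShortComplex C} (hS : S.ShortExact) (hT : T.ShortExact)
    (φ : S ⟶ T) {A₁ A₃ : C} {p₁ : T.X₁ ⟶ A₁} {p₃ : T.X₃ ⟶ A₃} (w₁ : φ.τ₁ ≫ p₁ = 0)
    (w₃ : φ.τ₃ ≫ p₃ = 0) (h₁ : (ShortComplex.mk φ.τ₁ p₁ w₁).ShortExact)
    (h₃ : (ShortComplex.mk φ.τ₃ p₃ w₃).ShortExact) :
    ∃ (A₂ : C) (p₂ : T.X₂ ⟶ A₂) (w₂ : φ.τ₂ ≫ p₂ = 0) (f : A₁ ⟶ A₂) (g : A₂ ⟶ A₃) (w : f ≫ g = 0),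
      (ShortComplex.mk φ.τ₂ p₂ w₂).ShortExact ∧ (ShortComplex.mk f g w).ShortExact := by
  have := hS.mono_f
  have := hS.epi_g
  have := hT.mono_f
  have := hT.epi_g
  have m₁ : Mono φ.τ₁ := h₁.mono_f
  have m₃ : Mono φ.τ₃ := h₃.mono_f
  let N : ShortComplex.SnakeInput C :=
    { L₀ := kernel φ
      L₁ := S
      L₂ := T
      L₃ := cokernel φ
      v₀₁ := kernel.ι φ
      v₁₂ := φ
      v₂₃ := cokernel.π φ
      w₀₂ := kernel.condition φ
      w₁₃ := cokernel.condition φ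
      h₀ := kernelIsKernel φ
      h₃ := cokernelIsCokernel φ
      L₁_exact := hS.exact
      L₂_exact := hT.exact
      epi_L₁_g := inferInstance
      mono_L₂_f := inferInstance }
  have z₃ : N.v₀₁.τ₃ = 0 := by
    rw [← cancel_mono φ.τ₃, zero_comp]
    exact N.w₀₂_τ₃
  have hδ : N.δ = 0 := by
    apply IsZero.eq_zero_of_src
    have : Mono N.v₀₁.τ₃ := N.mono_v₀₁_τ₃
    rw [IsZero.iff_id_eq_zero, ← cancel_mono N.v₀₁.τ₃, z₃, comp_zero, comp_zero]
  have : Mono N.L₃.f := (ShortComplex.exact_iff_mono _ hδ).1 N.L₂'_exact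
  have : Epi N.L₂.g := hT.epi_g
  have : Epi N.L₃.g := N.epi_L₃_g
  have hN : N.L₃.ShortExact := .mk' N.L₃_exact inferInstance inferInstance
  have : Mono φ.τ₂ := ShortComplex.mono_τ₂_of_exact_of_mono φ hS.exact
  let e₁ : N.L₃.X₁ ≅ A₁ := IsColimit.coconePointUniqueUpToIso N.h₃τ₁ h₁.gIsCokernel
  let e₃ : N.L₃.X₃ ≅ A₃ := IsColimit.coconePointUniqueUpToIso N.h₃τ₃ h₃.gIsCokernel
  exact ⟨N.L₃.X₂, N.v₂₃.τ₂, N.w₁₃_τ₂, _, _, _,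
    .mk' N.exact_C₂_down inferInstance N.epi_v₂₃_τ₂,
    shortExact_of_iso_right (shortExact_of_iso_left hN e₁) e₃⟩

/-- The kernels of a morphism of short exact sequences with epimorphic outer components form a
short exact sequence; the outer kernels may be chosen at will. -/
lemma exists_shortExact_kernels {S T : ShortComplex C} (hS : S.ShortExact) (hT : T.ShortExact)
    (φ : S ⟶ T) {A₁ A₃ : C} {i₁ : A₁ ⟶ S.X₁} {i₃ : A₃ ⟶ S.X₃} (w₁ : i₁ ≫ φ.τ₁ = 0)
    (w₃ : i₃ ≫ φ.τ₃ = 0) (h₁ : (ShortComplex.mk i₁ φ.τ₁ w₁).ShortExact)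
    (h₃ : (ShortComplex.mk i₃ φ.τ₃ w₃).ShortExact) :
    ∃ (A₂ : C) (i₂ : A₂ ⟶ S.X₂) (w₂ : i₂ ≫ φ.τ₂ = 0) (f : A₁ ⟶ A₂) (g : A₂ ⟶ A₃) (w : f ≫ g = 0),
      (ShortComplex.mk i₂ φ.τ₂ w₂).ShortExact ∧ (ShortComplex.mk f g w).ShortExact := by
  obtain ⟨A₂, p₂, w₂, f, g, w, h₂, h⟩ := exists_shortExact_cokernels hT.op hS.op
    (ShortComplex.opMap φ) (p₁ := i₃.op) (p₃ := i₁.op) (congrArg Quiver.Hom.op w₃)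
    (congrArg Quiver.Hom.op w₁) h₃.op h₁.op
  exact ⟨A₂.unop, p₂.unop, congrArg Quiver.Hom.unop w₂, g.unop, f.unop,
    congrArg Quiver.Hom.unop w, h₂.unop, h.unop⟩

end ShortExactSequences

/-! ### Gorenstein objects and two-sided resolutions -/

section TwoSidedResolutions

variable {C : Type u} [Category.{v} C] [Abelian C]

/-- A short exact sequence `0 ⟶ X₁ ⟶ P ⟶ X₃ ⟶ 0` with `P` projective that remains exact under
`Hom(-, Q)` for every projective object `Q`. -/
structure IsProperProjective (S : ShortComplex C) : Prop where
  shortExact : S.ShortExact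
  projective : Projective S.X₂
  exists_extension : ∀ (Q : C), Projective Q → ∀ f : S.X₁ ⟶ Q, ∃ g : S.X₂ ⟶ Q, S.f ≫ g = f

/-- A short exact sequence `0 ⟶ X₁ ⟶ I ⟶ X₃ ⟶ 0` with `I` injective that remains exact under
`Hom(J, -)` for every injective object `J`. -/
structure IsProperInjective (S : ShortComplex C) : Prop where
  shortExact : S.ShortExact
  injective : Injective S.X₂
  exists_lift : ∀ (J : C), Injective J → ∀ f : J ⟶ S.X₃, ∃ g : J ⟶ S.X₂, g ≫ S.g = f

/-- `X` belongs to a class of objects each member of which is the right end, and also the left end,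
of a short exact sequence satisfying `E` whose other end belongs to the class again. When `E`
implies short exactness, iterating in both directions and splicing yields an exact complex,
unbounded in both directions, with `X` among its syzygies. -/
def HasTwoSidedResolution (E : ShortComplex C → Prop) (X : C) : Prop :=
  ∃ 𝒮 : C → Prop, 𝒮 X ∧ ∀ Y, 𝒮 Y →
    (∃ S, E S ∧ Nonempty (S.X₃ ≅ Y) ∧ 𝒮 S.X₁) ∧ (∃ S, E S ∧ Nonempty (S.X₁ ≅ Y) ∧ 𝒮 S.X₃)

/-- A relation that can be continued in both directions admits a sequence indexed by `ℤ`. -/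
lemma exists_int_sequence {T : Type*} (r : T → T → Prop) (h₁ : ∀ x, ∃ y, r x y)
    (h₂ : ∀ y, ∃ x, r x y) (x₀ : T) : ∃ s : ℤ → T, s 0 = x₀ ∧ ∀ n, r (s n) (s (n + 1)) := by
  choose a ha using h₁
  choose b hb using h₂
  refine ⟨fun n ↦ match n with
    | Int.ofNat n => a^[n] x₀
    | Int.negSucc n => b^[n + 1] x₀, rfl, fun n ↦ ?_⟩
  match n with
  | Int.ofNat n =>
    change r (a^[n] x₀) (a^[n + 1] x₀)
    rw [Function.iterate_succ_apply']
    exact ha _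
  | Int.negSucc 0 => exact hb _
  | Int.negSucc (n + 1) =>
    change r (b^[n + 1 + 1] x₀) (b^[n + 1] x₀)
    rw [Function.iterate_succ_apply']
    exact hb _

lemma HasTwoSidedResolution.exists_sequence {E : ShortComplex C → Prop} {X : C}
    (h : HasTwoSidedResolution E X) :
    ∃ s : ℤ → ShortComplex C, (∀ n, E (s n)) ∧ (∀ n, Nonempty ((s (n + 1)).X₃ ≅ (s n).X₁)) ∧
      ∃ n, Nonempty (X ≅ (s n).X₁) := by
  obtain ⟨𝒮, hX, h𝒮⟩ := h
  obtain ⟨S₀, hS₀, ⟨e₀⟩, hS₀'⟩ := (h𝒮 X hX).2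
  let T := { S : ShortComplex C // E S ∧ (∃ Y, 𝒮 Y ∧ Nonempty (S.X₁ ≅ Y)) ∧
    ∃ Y, 𝒮 Y ∧ Nonempty (S.X₃ ≅ Y) }
  obtain ⟨s, hs₀, hs⟩ := exists_int_sequence
    (fun x y : T ↦ Nonempty (y.1.X₃ ≅ x.1.X₁))
    (by
      rintro ⟨S, _, ⟨Y, hY, ⟨e⟩⟩, _⟩
      obtain ⟨S', hS', ⟨e'⟩, hY'⟩ := (h𝒮 Y hY).1
      exact ⟨⟨S', hS', ⟨_, hY', ⟨Iso.refl _⟩⟩, ⟨_, hY, ⟨e'⟩⟩⟩, ⟨e' ≪≫ e.symm⟩⟩)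
    (by
      rintro ⟨S, _, _, ⟨Y, hY, ⟨e⟩⟩⟩
      obtain ⟨S', hS', ⟨e'⟩, hY'⟩ := (h𝒮 Y hY).2
      exact ⟨⟨S', hS', ⟨_, hY, ⟨e'⟩⟩, ⟨_, hY', ⟨Iso.refl _⟩⟩⟩, ⟨e ≪≫ e'.symm⟩⟩)
    ⟨S₀, hS₀, ⟨X, hX, ⟨e₀⟩⟩, ⟨_, hS₀', ⟨Iso.refl _⟩⟩⟩
  exact ⟨fun n ↦ (s n).1, fun n ↦ (s n).2.1, hs, 0, ⟨by
    change X ≅ (s 0).1.X₁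
    rw [hs₀]
    exact e₀.symm⟩⟩

lemma exact_of_factorization {S : ShortComplex C} (hS : S.Exact) {A D : C} (q : A ⟶ S.X₁) [Epi q]
    (j : S.X₃ ⟶ D) [Mono j] {f : A ⟶ S.X₂} {g : S.X₂ ⟶ D} (hf : f = q ≫ S.f) (hg : g = S.g ≫ j)
    (w : f ≫ g = 0) : (ShortComplex.mk f g w).Exact := by
  subst hf hg
  let φ : ShortComplex.mk (q ≫ S.f) (S.g ≫ j) w ⟶ ShortComplex.mk S.f (S.g ≫ j) (by simp) :=
    { τ₁ := q
      τ₂ := 𝟙 _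
      τ₃ := 𝟙 _ }
  have : Epi φ.τ₁ := ‹Epi q›
  have : IsIso φ.τ₂ := inferInstanceAs (IsIso (𝟙 _))
  have : Mono φ.τ₃ := inferInstanceAs (Mono (𝟙 _))
  rw [ShortComplex.exact_iff_of_epi_of_isIso_of_mono φ]
  let ψ : S ⟶ ShortComplex.mk S.f (S.g ≫ j) (by simp) :=
    { τ₁ := 𝟙 _
      τ₂ := 𝟙 _
      τ₃ := j }
  have : Epi ψ.τ₁ := inferInstanceAs (Epi (𝟙 _))
  have : IsIso ψ.τ₂ := inferInstanceAs (IsIso (𝟙 _))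
  have : Mono ψ.τ₃ := ‹Mono j›
  exact (ShortComplex.exact_iff_of_epi_of_isIso_of_mono ψ).1 hS

/-- The complex obtained by splicing short exact sequences along identifications of the right end
of each with the left end of the next. -/
noncomputable def splice (s : ℤ → ShortComplex C) (e : ∀ n, (s (n + 1)).X₃ ≅ (s n).X₁) :
    ChainComplex C ℤ :=
  ChainComplex.of (fun n ↦ (s n).X₂) (fun n ↦ (s (n + 1)).g ≫ (e n).hom ≫ (s n).f)
    (fun n ↦ by simp)

section Splice

variable (s : ℤ → ShortComplex C) (e : ∀ n, (s (n + 1)).X₃ ≅ (s n).X₁)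

lemma splice_d (n : ℤ) : (splice s e).d (n + 1) n = (s (n + 1)).g ≫ (e n).hom ≫ (s n).f :=
  (ChainComplex.of_d (fun n ↦ (s n).X₂) (fun n ↦ (s (n + 1)).g ≫ (e n).hom ≫ (s n).f) n :)

lemma acyclic_splice (hs : ∀ n, (s n).ShortExact) : (splice s e).Acyclic := by
  intro n
  obtain ⟨n, rfl⟩ : ∃ k, n = k + 1 := ⟨n - 1, by ring⟩
  rw [(splice s e).exactAt_iff' (n + 1 + 1) (n + 1) n (by simp) (by simp)]
  have := (hs (n + 1 + 1)).epi_g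
  have := (hs n).mono_f
  exact exact_of_factorization (hs (n + 1)).exact ((s (n + 1 + 1)).g ≫ (e (n + 1)).hom)
    ((e n).hom ≫ (s n).f) ((splice_d s e (n + 1)).trans (Category.assoc _ _ _).symm)
    (splice_d s e n) ((splice s e).d_comp_d _ _ _)

lemma nonempty_iso_kernel_splice (hs : ∀ n, (s n).ShortExact) (n k : ℤ) (h : k + 1 = n) :
    Nonempty ((s n).X₁ ≅ kernel ((splice s e).d n k)) := by
  subst h
  have := (hs k).mono_f
  have : Mono ((e k).hom ≫ (s k).f) := inferInstance
  rw [splice_d]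
  exact ⟨IsLimit.conePointUniqueUpToIso (hs (k + 1)).fIsKernel (limit.isLimit _) ≪≫
    (kernelCompMono (s (k + 1)).g ((e k).hom ≫ (s k).f)).symm⟩

end Splice

/-- For consecutive degrees `i, j, k` of an exact complex, the sequence
`0 ⟶ ker (Kᵢ ⟶ Kⱼ) ⟶ Kᵢ ⟶ ker (Kⱼ ⟶ Kₖ) ⟶ 0` linking adjacent syzygies. -/
noncomputable def syzygySequence (K : ChainComplex C ℤ) (i j k : ℤ) : ShortComplex C :=
  ShortComplex.mk (kernel.ι (K.d i j)) (kernel.lift (K.d j k) (K.d i j) (K.d_comp_d i j k))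
    (by rw [← cancel_mono (kernel.ι (K.d j k))]; simp)

lemma shortExact_syzygySequence {K : ChainComplex C ℤ} (hK : K.Acyclic) {i j k : ℤ}
    (hij : j + 1 = i) (hjk : k + 1 = j) : (syzygySequence K i j k).ShortExact := by
  have h := hK j
  rw [K.exactAt_iff' i j k (by simpa using hij) (by simp [← hjk])] at h
  have : Epi (kernel.lift (K.d j k) (K.d i j) (K.d_comp_d i j k)) :=
    h.epi_kernelLift
  refine .mk' ?_ (inferInstanceAs (Mono (kernel.ι (K.d i j)))) this
  let φ : syzygySequence K i j k ⟶ ShortComplex.mk _ _ (kernel.condition (K.d i j)) :=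
    { τ₁ := 𝟙 _
      τ₂ := 𝟙 _
      τ₃ := kernel.ι _
      comm₁₂ := by simp [syzygySequence]
      comm₂₃ := by simp [syzygySequence] }
  have : Epi φ.τ₁ := inferInstanceAs (Epi (𝟙 _))
  have : IsIso φ.τ₂ := inferInstanceAs (IsIso (𝟙 _))
  have : Mono φ.τ₃ := inferInstanceAs (Mono (kernel.ι _))
  exact (ShortComplex.exact_iff_of_epi_of_isIso_of_mono φ).2 (ShortComplex.exact_kernel _)

/-- The syzygies of an exact complex have two-sided resolutions built from its
syzygy sequences. -/
lemma hasTwoSidedResolution_of_iso_kernel {E : ShortComplex C → Prop} {K : ChainComplex C ℤ}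
    (hE : ∀ i j k : ℤ, j + 1 = i → k + 1 = j → E (syzygySequence K i j k)) {X : C} {n : ℤ}
    (e : X ≅ kernel (K.d n (n - 1))) : HasTwoSidedResolution E X := by
  refine ⟨fun Y ↦ ∃ i j : ℤ, j + 1 = i ∧ Nonempty (Y ≅ kernel (K.d i j)),
    ⟨n, n - 1, by ring, ⟨e⟩⟩, ?_⟩
  rintro Y ⟨i, j, hij, ⟨e⟩⟩
  exact ⟨⟨syzygySequence K (i + 1) i j, hE _ _ _ rfl hij, ⟨e.symm⟩, i + 1, i, rfl, ⟨Iso.refl _⟩⟩,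
    ⟨syzygySequence K i j (j - 1), hE _ _ _ hij (by ring), ⟨e.symm⟩, j, j - 1, by ring,
      ⟨Iso.refl _⟩⟩⟩

theorem isGorensteinProjective_iff {X : C} :
    IsGorensteinProjective X ↔ HasTwoSidedResolution IsProperProjective X := by
  constructor
  · rintro ⟨K, hK, n, ⟨e⟩⟩
    refine hasTwoSidedResolution_of_iso_kernel (fun i j k hij hjk ↦ ?_) e
    refine ⟨shortExact_syzygySequence hK.acyclic hij hjk, hK.projective _, fun Q hQ f ↦ ?_⟩
    have := (shortExact_syzygySequence hK.acyclic (rfl : i + 1 = i + 1) hij).epi_g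
    change kernel (K.d i j) ⟶ Q at f
    let q : K.X (i + 1) ⟶ kernel (K.d i j) := kernel.lift _ (K.d (i + 1) i) (K.d_comp_d _ _ _)
    have : Epi q := this
    obtain rfl : j = i - 1 := by lia
    obtain ⟨g, hg⟩ : ∃ g : K.X i ⟶ Q, K.d (i + 1) i ≫ g = q ≫ f := by
      have := hK.hom_exact Q hQ (i + 1) (q ≫ f) (by
        rw [← Category.assoc, show K.d (i + 1 + 1) (i + 1) ≫ q = 0 by
          rw [← cancel_mono (kernel.ι _)]; simp [q], zero_comp])
      have h : i + 1 - 1 = i := by ring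
      rwa [h] at this
    refine ⟨g, ?_⟩
    change kernel.ι (K.d i (i - 1)) ≫ g = f
    rw [← cancel_epi q, ← hg]
    simp [q]
  · intro h
    obtain ⟨s, hs, e, n, ⟨eX⟩⟩ := h.exists_sequence
    have e n := (e n).some
    have hs' n := (hs n).shortExact
    refine ⟨splice s e, ⟨fun n ↦ (hs n).projective, acyclic_splice s e hs', fun Q hQ n f hf ↦ ?_⟩,
      n, ⟨eX ≪≫ (nonempty_iso_kernel_splice s e hs' n (n - 1) (by ring)).some⟩⟩
    obtain ⟨k, rfl⟩ : ∃ k, n = k + 1 := ⟨n - 1, by ring⟩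
    suffices ∃ g : (splice s e).X k ⟶ Q, (splice s e).d (k + 1) k ≫ g = f by
      have h : k + 1 - 1 = k := by ring
      rwa [h]
    rw [splice_d] at hf ⊢
    change (s (k + 1)).X₂ ⟶ Q at f
    change ∃ g : (s k).X₂ ⟶ Q, ((s (k + 1)).g ≫ (e k).hom ≫ (s k).f) ≫ g = f
    have := (hs' (k + 1 + 1)).epi_g
    have hf : (s (k + 1)).f ≫ f = 0 := by
      rw [← cancel_epi (e (k + 1)).hom, ← cancel_epi (s (k + 1 + 1)).g]
      change ((s (k + 1 + 1)).g ≫ (e (k + 1)).hom ≫ (s (k + 1)).f) ≫ f = 0 at hf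
      simpa only [Category.assoc, comp_zero] using hf
    have := (hs' (k + 1)).epi_g
    obtain ⟨g, hg⟩ := (hs k).exists_extension Q hQ
      ((e k).inv ≫ (hs' (k + 1)).exact.desc f hf)
    exact ⟨g, by simp [hg]⟩

theorem isGorensteinInjective_iff {X : C} :
    IsGorensteinInjective X ↔ HasTwoSidedResolution IsProperInjective X := by
  constructor
  · rintro ⟨K, hK, n, ⟨e⟩⟩
    refine hasTwoSidedResolution_of_iso_kernel (fun i j k hij hjk ↦ ?_) e
    refine ⟨shortExact_syzygySequence hK.acyclic hij hjk, hK.injective _, fun J hJ f ↦ ?_⟩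
    change J ⟶ kernel (K.d j k) at f
    obtain rfl : k = j - 1 := by lia
    subst hij
    obtain ⟨g, hg⟩ := hK.hom_exact J hJ j (f ≫ kernel.ι _) (by simp)
    refine ⟨g, ?_⟩
    change g ≫ kernel.lift _ _ _ = f
    rw [← cancel_mono (kernel.ι _)]
    simpa using hg
  · intro h
    obtain ⟨s, hs, e, n, ⟨eX⟩⟩ := h.exists_sequence
    have e n := (e n).some
    have hs' n := (hs n).shortExact
    refine ⟨splice s e, ⟨fun n ↦ (hs n).injective, acyclic_splice s e hs', fun J hJ n f hf ↦ ?_⟩,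
      n, ⟨eX ≪≫ (nonempty_iso_kernel_splice s e hs' n (n - 1) (by ring)).some⟩⟩
    obtain ⟨k, rfl⟩ : ∃ k, n = k + 1 := ⟨n - 1, by ring⟩
    have hf : f ≫ (splice s e).d (k + 1) k = 0 := by
      have h : k + 1 - 1 = k := by ring
      rwa [h] at hf
    rw [splice_d] at hf ⊢
    change J ⟶ (s (k + 1)).X₂ at f
    change ∃ g : J ⟶ (s (k + 1 + 1)).X₂,
      g ≫ (s (k + 1 + 1)).g ≫ (e (k + 1)).hom ≫ (s (k + 1)).f = f
    have := (hs' k).mono_f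
    have hf : f ≫ (s (k + 1)).g = 0 := by
      rw [← cancel_mono (e k).hom, ← cancel_mono (s k).f]
      change f ≫ (s (k + 1)).g ≫ (e k).hom ≫ (s k).f = 0 at hf
      simpa only [Category.assoc, zero_comp] using hf
    have := (hs' (k + 1)).mono_f
    obtain ⟨g, hg⟩ := (hs (k + 1 + 1)).exists_lift J hJ
      ((hs' (k + 1)).exact.lift f hf ≫ (e (k + 1)).inv)
    exact ⟨g, by simp [reassoc_of% hg]⟩

end TwoSidedResolutions

/-! ### Vanishing of extensions by projective objects -/

section ExtVanishing

variable {C : Type u} [Category.{v} C] [Abelian C] [HasExt.{w} C]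

/-- `Extⁱ(X, Q)` vanishes for all projective objects `Q` and all `i ≥ n`. -/
def ExtVanishes (n : ℕ) (X : C) : Prop :=
  ∀ (Q : C), Projective Q → ∀ i, n ≤ i → ∀ e : Ext.{w} X Q i, e = 0

namespace ExtVanishes

lemma of_iso {n : ℕ} {X Y : C} (e : X ≅ Y) (h : ExtVanishes n X) : ExtVanishes n Y := by
  intro Q hQ i hi x
  rw [← x.mk₀_id_comp, ← e.inv_hom_id, ← Ext.mk₀_comp_mk₀, Ext.comp_assoc_of_second_deg_zero,
    h Q hQ i hi ((Ext.mk₀ e.hom).comp x (zero_add i)), Ext.comp_zero]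

lemma mono {n k : ℕ} (hnk : n ≤ k) {X : C} (h : ExtVanishes n X) : ExtVanishes k X :=
  fun Q hQ i hi ↦ h Q hQ i (hnk.trans hi)

lemma of_projective (X : C) [Projective X] : ExtVanishes 1 X := by
  intro Q hQ i hi e
  exact e.eq_zero_of_hasProjectiveDimensionLT 1 hi

variable {S : ShortComplex C} (hS : S.ShortExact) {n : ℕ}
include hS

lemma X₁ (h₂ : ExtVanishes n S.X₂) (h₃ : ExtVanishes (n + 1) S.X₃) :
    ExtVanishes n S.X₁ := by
  intro Q hQ i hi x₁
  obtain ⟨x₂, rfl⟩ := Ext.contravariant_sequence_exact₁ hS _ x₁ (add_comm _ _)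
    (h₃ Q hQ (i + 1) (by lia) _)
  rw [h₂ Q hQ i hi x₂, Ext.comp_zero]

lemma X₂ (h₁ : ExtVanishes n S.X₁) (h₃ : ExtVanishes n S.X₃) :
    ExtVanishes n S.X₂ := by
  intro Q hQ i hi x₂
  obtain ⟨x₃, rfl⟩ := Ext.contravariant_sequence_exact₂ hS _ x₂ (h₁ Q hQ i hi _)
  rw [h₃ Q hQ i hi x₃, Ext.comp_zero]

lemma X₃ (h₁ : ExtVanishes n S.X₁) (h₂ : ExtVanishes (n + 1) S.X₂) :
    ExtVanishes (n + 1) S.X₃ := by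
  intro Q hQ i hi x₃
  obtain ⟨i, rfl⟩ : ∃ j, i = j + 1 := ⟨i - 1, by lia⟩
  obtain ⟨x₁, rfl⟩ := Ext.contravariant_sequence_exact₃ hS _ x₃ (h₂ Q hQ (i + 1) hi _)
    (add_comm _ _)
  rw [h₁ Q hQ i (by lia) x₁, Ext.comp_zero]

lemma exists_extension (h₃ : ExtVanishes 1 S.X₃) {Q : C} (hQ : Projective Q) (f : S.X₁ ⟶ Q) :
    ∃ g : S.X₂ ⟶ Q, S.f ≫ g = f := by
  obtain ⟨x, hx⟩ := Ext.contravariant_sequence_exact₁ hS Q (Ext.mk₀ f) (add_zero 1)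
    (h₃ Q hQ 1 le_rfl _)
  obtain ⟨g, rfl⟩ := Ext.homEquiv₀.symm.surjective x
  exact ⟨g, Ext.homEquiv₀.symm.injective (by simpa using hx)⟩

end ExtVanishes

end ExtVanishing

/-! ### Objects of finite Gorenstein projective dimension -/

section GorensteinProjective

variable {C : Type u} [Category.{v} C] [Abelian C]

lemma IsGorensteinProjective.of_iso {X Y : C} (e : X ≅ Y) (h : IsGorensteinProjective X) :
    IsGorensteinProjective Y := by
  obtain ⟨P, hP, n, ⟨f⟩⟩ := h
  exact ⟨P, hP, n, ⟨e.symm ≪≫ f⟩⟩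

lemma isGorensteinProjective_of_projective (X : C) (hX : Projective X) :
    IsGorensteinProjective X := by
  rw [isGorensteinProjective_iff]
  refine ⟨Projective, hX, fun Y hY ↦ ⟨⟨ShortComplex.mk (0 : 0 ⟶ Y) (𝟙 Y) (by simp),
    ⟨?_, hY, fun Q _ f ↦ ⟨0, (isZero_zero C).eq_of_src _ _⟩⟩, ⟨Iso.refl _⟩,
    (inferInstance : Projective (0 : C))⟩, ⟨ShortComplex.mk (𝟙 Y) (0 : Y ⟶ 0) (by simp),
    ⟨?_, hY, fun Q _ f ↦ ⟨f, Category.id_comp _⟩⟩, ⟨Iso.refl _⟩,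
    (inferInstance : Projective (0 : C))⟩⟩⟩
  · have : Mono (0 : 0 ⟶ Y) := (isZero_zero C).mono _
    exact .mk' ((ShortComplex.exact_iff_mono _ rfl).2 inferInstance) this inferInstance
  · have : Epi (0 : Y ⟶ 0) := (isZero_zero C).epi _
    exact .mk' ((ShortComplex.exact_iff_epi _ rfl).2 inferInstance) inferInstance this

variable [HasExt.{w} C]

/-- Dimension shifting along a resolution of `X` to the left. -/
lemma IsGorensteinProjective.extVanishes {X : C} (h : IsGorensteinProjective X) :
    ExtVanishes 1 X := by
  rw [isGorensteinProjective_iff] at h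
  obtain ⟨𝒮, hX, h𝒮⟩ := h
  suffices ∀ (i : ℕ) (Y : C), 𝒮 Y → ∀ Q, Projective Q → ∀ e : Ext.{w} Y Q (i + 1), e = 0 by
    intro Q hQ i hi
    obtain ⟨i, rfl⟩ : ∃ j, i = j + 1 := ⟨i - 1, by lia⟩
    exact this i X hX Q hQ
  intro i
  induction i with
  | zero =>
    intro Y hY Q hQ e
    obtain ⟨S, hS, ⟨eS⟩, -⟩ := (h𝒮 Y hY).1
    have hS' := shortExact_of_iso_right hS.shortExact eS
    have := hS.projective
    obtain ⟨x, rfl⟩ := Ext.contravariant_sequence_exact₃ hS' _ e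
      (Ext.eq_zero_of_hasProjectiveDimensionLT (X := S.X₂) _ 1 le_rfl) (add_zero 1)
    obtain ⟨f, rfl⟩ := Ext.homEquiv₀.symm.surjective x
    obtain ⟨g, hg⟩ := hS.exists_extension Q hQ f
    have : Ext.homEquiv₀.symm f = (Ext.mk₀ S.f).comp (Ext.mk₀ g) (zero_add 0) := by simp [hg]
    rw [this]
    exact hS'.extClass_comp_assoc _
  | succ i hi =>
    intro Y hY Q hQ e
    obtain ⟨S, hS, ⟨eS⟩, hS₁⟩ := (h𝒮 Y hY).1
    have := hS.projective
    obtain ⟨x, rfl⟩ := Ext.contravariant_sequence_exact₃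
      (shortExact_of_iso_right hS.shortExact eS) _ e
      (Ext.eq_zero_of_hasProjectiveDimensionLT (X := S.X₂) _ 1 (by lia)) (add_comm 1 (i + 1))
    rw [hi _ hS₁ Q hQ x, Ext.comp_zero]

lemma HasGorensteinProjectiveDimLE.extVanishes {n : ℕ} {X : C}
    (h : HasGorensteinProjectiveDimLE n X) : ExtVanishes (n + 1) X := by
  induction n generalizing X with
  | zero => exact IsGorensteinProjective.extVanishes h
  | succ n hn =>
    obtain ⟨S, hS, ⟨e⟩, h₂, h₁⟩ := h
    exact (ExtVanishes.X₃ hS (hn h₁) (h₂.extVanishes.mono (by lia))).of_iso e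

/-- `X` belongs to a class of objects without higher extensions by projective objects, each member
of which embeds into a projective object with cokernel in the class. -/
def HasProperProjectiveCoresolution (X : C) : Prop :=
  ∃ 𝒮 : C → Prop, 𝒮 X ∧ ∀ Y, 𝒮 Y → ExtVanishes 1 Y ∧
    ∃ (P Z : C) (f : Y ⟶ P) (g : P ⟶ Z) (w : f ≫ g = 0),
      (ShortComplex.mk f g w).ShortExact ∧ Projective P ∧ 𝒮 Z

namespace HasProperProjectiveCoresolution

lemma extVanishes {X : C} (h : HasProperProjectiveCoresolution X) : ExtVanishes 1 X := by
  obtain ⟨𝒮, hX, h𝒮⟩ := h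
  exact (h𝒮 X hX).1

lemma exists_shortExact {X : C} (h : HasProperProjectiveCoresolution X) :
    ∃ (P Z : C) (f : X ⟶ P) (g : P ⟶ Z) (w : f ≫ g = 0), (ShortComplex.mk f g w).ShortExact ∧
      Projective P ∧ HasProperProjectiveCoresolution Z := by
  obtain ⟨𝒮, hX, h𝒮⟩ := h
  obtain ⟨P, Z, f, g, w, hS, hP, hZ⟩ := (h𝒮 X hX).2
  exact ⟨P, Z, f, g, w, hS, hP, 𝒮, hZ, h𝒮⟩

lemma of_isGorensteinProjective {X : C} (h : IsGorensteinProjective X) :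
    HasProperProjectiveCoresolution X := by
  rw [isGorensteinProjective_iff] at h
  obtain ⟨𝒮, hX, h𝒮⟩ := h
  refine ⟨𝒮, hX, fun Y hY ↦ ⟨IsGorensteinProjective.extVanishes
    (isGorensteinProjective_iff.2 ⟨𝒮, hY, h𝒮⟩), ?_⟩⟩
  obtain ⟨S, hS, ⟨e⟩, h₃⟩ := (h𝒮 Y hY).2
  exact ⟨_, _, _, _, _, shortExact_of_iso_left hS.shortExact e, hS.projective, h₃⟩

/-- Dual horseshoe: embeddings of the outer terms into projective objects combine, since the first
one extends to the middle term. -/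
lemma X₂ {S : ShortComplex C} (hS : S.ShortExact) (h₁ : HasProperProjectiveCoresolution S.X₁)
    (h₃ : HasProperProjectiveCoresolution S.X₃) :
    HasProperProjectiveCoresolution S.X₂ := by
  refine ⟨fun Y ↦ ∃ S : ShortComplex C, S.ShortExact ∧ S.X₂ = Y ∧
    HasProperProjectiveCoresolution S.X₁ ∧ HasProperProjectiveCoresolution S.X₃,
    ⟨S, hS, rfl, h₁, h₃⟩, ?_⟩
  rintro _ ⟨S, hS, rfl, h₁, h₃⟩
  refine ⟨ExtVanishes.X₂ hS h₁.extVanishes h₃.extVanishes, ?_⟩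
  obtain ⟨P, Z, f, g, w, hT, hP, hZ⟩ := h₁.exists_shortExact
  obtain ⟨P', Z', f', g', w', hT', hP', hZ'⟩ := h₃.exists_shortExact
  obtain ⟨a, ha⟩ := h₃.extVanishes.exists_extension hS hP f
  let φ : S ⟶ ShortComplex.mk (biprod.inl : P ⟶ P ⊞ P') biprod.snd (by simp) :=
    { τ₁ := f
      τ₂ := biprod.lift a (S.g ≫ f')
      τ₃ := f'
      comm₁₂ := by ext <;> simp [ha] }
  obtain ⟨A, p, wp, i, q, wi, hp, hi⟩ :=
    exists_shortExact_cokernels hS (shortExact_biprod P P') φ w w' hT hT'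
  exact ⟨_, _, _, _, _, hp, inferInstanceAs (Projective (P ⊞ P')), _, hi, rfl, hZ, hZ'⟩

end HasProperProjectiveCoresolution

/-- An object of Gorenstein projective dimension at most `n` embeds into an object of projective
dimension at most `n`. -/
lemma HasGorensteinProjectiveDimLE.exists_embedding {n : ℕ} {X : C}
    (h : HasGorensteinProjectiveDimLE n X) :
    ∃ (L Z : C) (f : X ⟶ L) (g : L ⟶ Z) (w : f ≫ g = 0), (ShortComplex.mk f g w).ShortExact ∧
      HasProjectiveDimensionLE L n ∧ HasProperProjectiveCoresolution Z := by
  induction n generalizing X with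
  | zero =>
    obtain ⟨P, Z, f, g, w, hS, hP, hZ⟩ :=
      (HasProperProjectiveCoresolution.of_isGorensteinProjective h).exists_shortExact
    exact ⟨P, Z, f, g, w, hS, inferInstance, hZ⟩
  | succ n hn =>
    obtain ⟨S, hS, ⟨e⟩, h₂, h₁⟩ := h
    obtain ⟨L, Z, f, g, w, hT, hL, hZ⟩ := hn h₁
    have sq := IsPushout.of_hasPushout S.f f
    have hXE := shortExact_of_iso_right (shortExact_of_isPushout sq S.zero hS) e
    have hE : HasProperProjectiveCoresolution (pushout S.f f) :=
      HasProperProjectiveCoresolution.X₂ (shortExact_of_isPushout sq.flip w hT)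
        (.of_isGorensteinProjective h₂) hZ
    obtain ⟨P, Z', i, p, wi, hP', hP, hZ'⟩ := hE.exists_shortExact
    -- The quotient `P / L` contains `E / L = X`, with cokernel `P / E`.
    have hid : (ShortComplex.mk (𝟙 L) (0 : L ⟶ 0) (by simp)).ShortExact := by
      have : Epi (0 : L ⟶ 0) := (isZero_zero C).epi _
      exact .mk' ((ShortComplex.exact_iff_epi _ rfl).2 inferInstance) inferInstance this
    have hid' : (ShortComplex.mk (0 : 0 ⟶ Z') (𝟙 Z') (by simp)).ShortExact := by
      have : Mono (0 : 0 ⟶ Z') := (isZero_zero C).mono _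
      exact .mk' ((ShortComplex.exact_iff_mono _ rfl).2 inferInstance) this inferInstance
    let φ : ShortComplex.mk (𝟙 L) (0 : L ⟶ 0) (by simp) ⟶ ShortComplex.mk i p wi :=
      { τ₁ := pushout.inr S.f f
        τ₂ := pushout.inr S.f f ≫ i
        τ₃ := 0
        comm₂₃ := by simp [wi] }
    obtain ⟨L', q, wq, a, b, wa, hq, ha⟩ :=
      exists_shortExact_cokernels hid hP' φ (by simp [φ]) (by simp [φ]) hXE hid'
    exact ⟨_, _, _, _, _, ha, hq.hasProjectiveDimensionLT_X₃ (n + 1) hL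
      (hasProjectiveDimensionLT_of_ge P 1 _ (by lia)), hZ'⟩

end GorensteinProjective

/-! ### Projective syzygies -/

section Syzygies

variable {C : Type u} [Category.{v} C] [Abelian C]

/-- `IsProjectiveSyzygy n X Y` says that `Y` is an `n`-th syzygy of `X`, i.e. the kernel at the
`n`-th stage of some projective resolution of `X`. -/
def IsProjectiveSyzygy : ℕ → C → C → Prop
  | 0, X, Y => Nonempty (X ≅ Y)
  | n + 1, X, Y => ∃ S : ShortComplex C, S.ShortExact ∧ Nonempty (S.X₃ ≅ X) ∧ Projective S.X₂ ∧
      IsProjectiveSyzygy n S.X₁ Y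

namespace IsProjectiveSyzygy

lemma succ {n : ℕ} {X : C} {S : ShortComplex C} (hS : S.ShortExact) (hP : Projective S.X₂)
    (h : IsProjectiveSyzygy n X S.X₃) : IsProjectiveSyzygy (n + 1) X S.X₁ := by
  induction n generalizing X with
  | zero => exact ⟨S, hS, ⟨h.some.symm⟩, hP, ⟨Iso.refl _⟩⟩
  | succ n hn =>
    obtain ⟨T, hT, e, hT₂, hT₁⟩ := h
    exact ⟨T, hT, e, hT₂, hn hT₁⟩

lemma projective {n : ℕ} {X Y : C} (h : IsProjectiveSyzygy n X Y)
    (hX : HasProjectiveDimensionLE X n) : Projective Y := by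
  induction n generalizing X with
  | zero =>
    have := projective_iff_hasProjectiveDimensionLE_zero X |>.2 hX
    exact Projective.of_iso h.some this
  | succ n hn =>
    obtain ⟨S, hS, ⟨e⟩, h₂, h₁⟩ := h
    exact hn h₁ ((hS.hasProjectiveDimensionLT_X₃_iff n h₂).1
      (hasProjectiveDimensionLT_of_iso e.symm _))

lemma extVanishes [HasExt.{w} C] {n : ℕ} {X Y : C} (h : IsProjectiveSyzygy n X Y)
    (hX : ExtVanishes (n + 1) X) : ExtVanishes 1 Y := by
  induction n generalizing X with
  | zero => exact hX.of_iso h.some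
  | succ n hn =>
    obtain ⟨S, hS, ⟨e⟩, h₂, h₁⟩ := h
    exact hn h₁ (ExtVanishes.X₁ hS ((ExtVanishes.of_projective S.X₂).mono (by lia))
      (hX.of_iso e.symm))

lemma exists_of_enoughProjectives [EnoughProjectives C] (n : ℕ) (X : C) :
    ∃ Y, IsProjectiveSyzygy n X Y := by
  induction n generalizing X with
  | zero => exact ⟨X, ⟨Iso.refl X⟩⟩
  | succ n hn =>
    obtain ⟨Y, hY⟩ := hn (kernel (Projective.π X))
    exact ⟨Y, _, shortExact_kernel (Projective.π X), ⟨Iso.refl _⟩,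
      inferInstanceAs (Projective (Projective.over X)), hY⟩

/-- Horseshoe lemma: a given syzygy of the left term of a short exact sequence is the left term of
a short exact sequence of syzygies. -/
lemma exists_shortExact [EnoughProjectives C] {n : ℕ} {S : ShortComplex C} (hS : S.ShortExact)
    {Y : C} (h : IsProjectiveSyzygy n S.X₁ Y) :
    ∃ T : ShortComplex C, T.ShortExact ∧ Nonempty (T.X₁ ≅ Y) ∧
      IsProjectiveSyzygy n S.X₂ T.X₂ ∧ IsProjectiveSyzygy n S.X₃ T.X₃ := by
  induction n generalizing S with
  | zero => exact ⟨S, hS, h, ⟨Iso.refl _⟩, ⟨Iso.refl _⟩⟩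
  | succ n hn =>
    obtain ⟨U, hU, ⟨e⟩, h₂, h₁⟩ := h
    have := hS.epi_g
    let π := Projective.π S.X₃
    let a : Projective.over S.X₃ ⟶ S.X₂ := Projective.factorThru π S.g
    let φ : ShortComplex.mk (biprod.inl : U.X₂ ⟶ U.X₂ ⊞ Projective.over S.X₃) biprod.snd
        (by simp) ⟶ S :=
      { τ₁ := U.g ≫ e.hom
        τ₂ := biprod.desc ((U.g ≫ e.hom) ≫ S.f) a
        τ₃ := π
        comm₂₃ := by ext <;> simp [a] }
    obtain ⟨A, i, wi, f, g, w, hi, hA⟩ := exists_shortExact_kernels (shortExact_biprod _ _) hS φ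
      (by simp [φ]) (kernel.condition π) (shortExact_of_iso_right hU e) (shortExact_kernel π)
    obtain ⟨T, hT, hT₁, hT₂, hT₃⟩ := hn hA h₁
    exact ⟨T, hT, hT₁, ⟨_, hi, ⟨Iso.refl _⟩,
      inferInstanceAs (Projective (U.X₂ ⊞ Projective.over S.X₃)), hT₂⟩,
      ⟨_, shortExact_kernel π, ⟨Iso.refl _⟩,
        inferInstanceAs (Projective (Projective.over S.X₃)), hT₃⟩⟩

lemma hasGorensteinProjectiveDimLE {n : ℕ} {X Y : C} (h : IsProjectiveSyzygy n X Y)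
    (hY : IsGorensteinProjective Y) : HasGorensteinProjectiveDimLE n X := by
  induction n generalizing X with
  | zero => exact hY.of_iso h.some.symm
  | succ n hn =>
    obtain ⟨S, hS, e, h₂, h₁⟩ := h
    exact ⟨S, hS, e, isGorensteinProjective_of_projective _ h₂, hn h₁⟩

/-- If injective objects have projective dimension at most `n` and projective objects have
injective dimension at most `n`, every `n`-th syzygy is Gorenstein projective: the horseshoe lemma
for `0 ⟶ X ⟶ I ⟶ X' ⟶ 0` with `I` injective embeds an `n`-th syzygy of `X` into a projective
object with an `n`-th syzygy of `X'` as cokernel. -/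
lemma isGorensteinProjective [EnoughProjectives C] [EnoughInjectives C] {n : ℕ}
    (hI : ∀ I : C, Injective I → HasProjectiveDimensionLE I n)
    (hP : ∀ P : C, Projective P → HasInjectiveDimensionLE P n) {X Y : C}
    (h : IsProjectiveSyzygy n X Y) : IsGorensteinProjective Y := by
  let := HasExt.standard C
  have hV (X : C) : ExtVanishes (n + 1) X := fun Q hQ i hi e ↦
    have := hP Q hQ
    e.eq_zero_of_hasInjectiveDimensionLT (n + 1) hi
  rw [isGorensteinProjective_iff]
  refine ⟨fun Y ↦ ∃ X, IsProjectiveSyzygy n X Y, ⟨X, h⟩, ?_⟩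
  rintro Y ⟨X, h⟩
  constructor
  · have hS := shortExact_kernel (Projective.π Y)
    have hP : Projective (Projective.over Y) := inferInstance
    obtain ⟨S, -, -, -, h'⟩ := succ hS hP h
    exact ⟨_, ⟨hS, hP, fun Q hQ f ↦ (h.extVanishes (hV X)).exists_extension hS hQ f⟩,
      ⟨Iso.refl _⟩, S.X₁, h'⟩
  · obtain ⟨T, hT, hT₁, hT₂, hT₃⟩ := exists_shortExact (shortExact_cokernel (Injective.ι X)) h
    exact ⟨T, ⟨hT, hT₂.projective (hI _ (inferInstanceAs (Injective (Injective.under X)))),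
      fun Q hQ f ↦ (hT₃.extVanishes (hV _)).exists_extension hT hQ f⟩, hT₁, _, hT₃⟩

end IsProjectiveSyzygy

end Syzygies

/-! ### Global dimensions -/

section GlobalDimensions

variable {C : Type u} [Category.{v} C] [Abelian C]

lemma gorensteinProjectiveDim_le_iff {X : C} {n : ℕ} :
    gorensteinProjectiveDim X ≤ n ↔ ∃ k ≤ n, HasGorensteinProjectiveDimLE k X := by
  rw [← ENat.lt_add_one_iff (ENat.natCast_ne_top n)]
  simp only [gorensteinProjectiveDim, iInf_lt_iff]
  norm_cast
  simp [and_comm]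

lemma spli_le_iff {n : ℕ} :
    spli C ≤ n ↔ ∀ I : C, Injective I → HasProjectiveDimensionLE I n := by
  simp only [spli, iSup_le_iff, projectiveDimension_le_iff]

lemma silp_le_iff {n : ℕ} :
    silp C ≤ n ↔ ∀ P : C, Projective P → HasInjectiveDimensionLE P n := by
  simp only [silp, iSup_le_iff, injectiveDimension_le_iff]

/-- Retraction of the embedding of an injective object into an object of finite projective
dimension. -/
lemma HasGorensteinProjectiveDimLE.hasProjectiveDimensionLE {n : ℕ} {I : C} [Injective I]
    (h : HasGorensteinProjectiveDimLE n I) : HasProjectiveDimensionLE I n := by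
  let := HasExt.standard C
  obtain ⟨L, Z, f, g, w, hS, hL, -⟩ := h.exists_embedding
  have : Mono f := hS.mono_f
  exact Retract.hasProjectiveDimensionLT ⟨f, Injective.factorThru (𝟙 I) f, by simp⟩ _

/-- If `Extⁱ(-, P)` vanishes for projective `P` and `i ≥ n`, a finite projective dimension is
already less than `n`: if `Extⁱ⁺¹(I, -) = 0`, then `Extⁱ(I, -)` is right exact, so it vanishes as
soon as it vanishes on projective objects. -/
lemma hasProjectiveDimensionLT_of_hasInjectiveDimensionLT [EnoughProjectives C] {n : ℕ}
    (hP : ∀ P : C, Projective P → HasInjectiveDimensionLT P n) {I : C} {k : ℕ}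
    (hI : HasProjectiveDimensionLT I (n + k)) : HasProjectiveDimensionLT I n := by
  let := HasExt.standard C
  induction k with
  | zero => exact hI
  | succ k hk =>
    refine hk ((hasProjectiveDimensionLT_iff _ _).2 fun i hi Y e ↦ ?_)
    have hS := shortExact_kernel (Projective.π Y)
    have := hP (Projective.over Y) inferInstance
    obtain ⟨x, rfl⟩ := Ext.covariant_sequence_exact₃ I hS e rfl
      (Ext.eq_zero_of_hasProjectiveDimensionLT _ (n + (k + 1)) (by lia))
    have hx : x = 0 := Ext.eq_zero_of_hasInjectiveDimensionLT (X := Projective.over Y) x n (by lia)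
    rw [hx, Ext.zero_comp]

/-- Strict bounds are needed here: `b ≤ n` for natural `n` does not tell `b = ⊥` from `b = 0`. -/
lemma le_of_forall_natCast_lt {a b : WithBot ℕ∞} (h : ∀ n : ℕ, b < n → a < n) : a ≤ b := by
  induction b with
  | bot =>
    rw [le_bot_iff, ← WithBot.lt_coe_bot]
    exact h 0 (WithBot.bot_lt_coe _)
  | coe b =>
    induction b with
    | top => exact le_top
    | coe k =>
      refine ENat.WithBot.lt_add_one_iff.1 ?_
      exact_mod_cast h (k + 1) (ENat.WithBot.lt_add_one_iff.2 le_rfl)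

lemma eq_of_forall_le_natCast_iff {a b : ℕ∞} (h : ∀ n : ℕ, a ≤ n ↔ b ≤ n) : a = b := by
  have le {a b : ℕ∞} (h : ∀ n : ℕ, b ≤ n → a ≤ n) : a ≤ b := by
    induction b with
    | top => exact le_top
    | coe n => exact h n le_rfl
  exact le_antisymm (le fun n ↦ (h n).2) (le fun n ↦ (h n).1)

lemma spli_le_silp [EnoughProjectives C] {m : ℕ} (h : spli C ≤ m) : spli C ≤ silp C := by
  refine iSup₂_le fun I hI ↦ le_of_forall_natCast_lt fun n hn ↦ projectiveDimension_lt_iff.2 ?_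
  have := spli_le_iff.1 h I hI
  exact hasProjectiveDimensionLT_of_hasInjectiveDimensionLT
    (fun P hP ↦ injectiveDimension_lt_iff.1 ((le_iSup₂_of_le P hP le_rfl).trans_lt hn))
    (hasProjectiveDimensionLT_of_ge I (m + 1) (n + (m + 1)) (by lia))

theorem globalGorensteinProjectiveDim_le_iff [EnoughProjectives C] [EnoughInjectives C] {m : ℕ} :
    globalGorensteinProjectiveDim C ≤ m ↔ spli C ≤ m ∧ silp C ≤ m := by
  simp only [globalGorensteinProjectiveDim, iSup_le_iff, gorensteinProjectiveDim_le_iff,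
    spli_le_iff, silp_le_iff]
  refine ⟨fun h ↦ ⟨fun I hI ↦ ?_, fun P hP ↦ ?_⟩, fun ⟨hI, hP⟩ X ↦ ?_⟩
  · obtain ⟨k, hk, h⟩ := h I
    have := h.hasProjectiveDimensionLE
    exact hasProjectiveDimensionLT_of_ge I (k + 1) _ (by lia)
  · let := HasExt.standard C
    refine (hasInjectiveDimensionLT_iff _ _).2 fun i hi X e ↦ ?_
    obtain ⟨k, hk, h⟩ := h X
    exact h.extVanishes P hP i (by lia) e
  · obtain ⟨Y, hY⟩ := IsProjectiveSyzygy.exists_of_enoughProjectives m X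
    exact ⟨m, le_rfl, hY.hasGorensteinProjectiveDimLE (hY.isGorensteinProjective hI hP)⟩

end GlobalDimensions

/-! ### Passing to the opposite category -/

section Duality

variable {C : Type u} [Category.{v} C] [Abelian C]

lemma isProperProjective_op_iff {S : ShortComplex C} :
    IsProperProjective S.op ↔ IsProperInjective S := by
  constructor
  · intro h
    have : Projective (op S.X₂) := h.projective
    refine ⟨h.shortExact.unop, inferInstanceAs (Injective (op S.X₂).unop), fun J hJ f ↦ ?_⟩
    obtain ⟨g, hg⟩ := h.exists_extension (op J) inferInstance f.op
    exact ⟨g.unop, Quiver.Hom.op_inj hg⟩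
  · intro h
    have := h.injective
    refine ⟨h.shortExact.op, inferInstanceAs (Projective (op S.X₂)), fun Q hQ f ↦ ?_⟩
    obtain ⟨g, hg⟩ := h.exists_lift Q.unop inferInstance f.unop
    exact ⟨g.op, Quiver.Hom.unop_inj hg⟩

lemma isProperInjective_unop_iff {S : ShortComplex Cᵒᵖ} :
    IsProperInjective S.unop ↔ IsProperProjective S :=
  isProperProjective_op_iff.symm

theorem isGorensteinProjective_op_iff {X : C} :
    IsGorensteinProjective (op X) ↔ IsGorensteinInjective X := by
  rw [isGorensteinProjective_iff, isGorensteinInjective_iff]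
  constructor
  · rintro ⟨𝒮, hX, h𝒮⟩
    refine ⟨fun Y ↦ 𝒮 (op Y), hX, fun Y hY ↦ ⟨?_, ?_⟩⟩
    · obtain ⟨S, hS, ⟨e⟩, h⟩ := (h𝒮 _ hY).2
      exact ⟨S.unop, isProperInjective_unop_iff.2 hS, ⟨e.unop.symm⟩, h⟩
    · obtain ⟨S, hS, ⟨e⟩, h⟩ := (h𝒮 _ hY).1
      exact ⟨S.unop, isProperInjective_unop_iff.2 hS, ⟨e.unop.symm⟩, h⟩
  · rintro ⟨𝒮, hX, h𝒮⟩
    refine ⟨fun Y ↦ 𝒮 Y.unop, hX, fun Y hY ↦ ⟨?_, ?_⟩⟩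
    · obtain ⟨S, hS, ⟨e⟩, h⟩ := (h𝒮 _ hY).2
      exact ⟨S.op, isProperProjective_op_iff.2 hS, ⟨e.op.symm⟩, h⟩
    · obtain ⟨S, hS, ⟨e⟩, h⟩ := (h𝒮 _ hY).1
      exact ⟨S.op, isProperProjective_op_iff.2 hS, ⟨e.op.symm⟩, h⟩

lemma hasGorensteinProjectiveDimLE_op_iff {n : ℕ} {X : C} :
    HasGorensteinProjectiveDimLE n (op X) ↔ HasGorensteinInjectiveDimLE n X := by
  induction n generalizing X with
  | zero => exact isGorensteinProjective_op_iff
  | succ n hn =>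
    constructor
    · rintro ⟨S, hS, ⟨e⟩, h₂, h₁⟩
      exact ⟨S.unop, hS.unop, ⟨e.unop.symm⟩, isGorensteinProjective_op_iff.1 h₂, hn.1 h₁⟩
    · rintro ⟨S, hS, ⟨e⟩, h₂, h₁⟩
      exact ⟨S.op, hS.op, ⟨e.op.symm⟩, isGorensteinProjective_op_iff.2 h₂, hn.2 h₁⟩

variable (C) in
lemma globalGorensteinProjectiveDim_op :
    globalGorensteinProjectiveDim Cᵒᵖ = globalGorensteinInjectiveDim C :=
  Equiv.iSup_congr equivToOpposite.symm fun X ↦ by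
    simp only [gorensteinProjectiveDim, gorensteinInjectiveDim,
      ← hasGorensteinProjectiveDimLE_op_iff]
    rfl

lemma hasProjectiveDimensionLT_op_iff [EnoughInjectives C] {n : ℕ} {X : C} :
    HasProjectiveDimensionLT (op X) n ↔ HasInjectiveDimensionLT X n := by
  obtain _ | n := n
  · rw [hasProjectiveDimensionLT_zero_iff_isZero, hasInjectiveDimensionLT_zero_iff_isZero]
    exact ⟨fun h ↦ h.unop, fun h ↦ h.op⟩
  induction n generalizing X with
  | zero =>
    rw [zero_add, ← projective_iff_hasProjectiveDimensionLT_one,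
      ← injective_iff_hasInjectiveDimensionLT_one]
    exact ⟨fun _ ↦ inferInstanceAs (Injective (op X).unop), fun _ ↦ inferInstance⟩
  | succ n hn =>
    have hS := shortExact_cokernel (Injective.ι X)
    exact (hS.op.hasProjectiveDimensionLT_X₃_iff n
      (inferInstanceAs (Projective (op (Injective.under X))))).trans
      (hn.trans (hS.hasInjectiveDimensionLT_X₃_iff n
        (inferInstanceAs (Injective (Injective.under X)))))

lemma hasInjectiveDimensionLT_op_iff [EnoughProjectives C] {n : ℕ} {X : C} :
    HasInjectiveDimensionLT (op X) n ↔ HasProjectiveDimensionLT X n := by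
  obtain _ | n := n
  · rw [hasProjectiveDimensionLT_zero_iff_isZero, hasInjectiveDimensionLT_zero_iff_isZero]
    exact ⟨fun h ↦ h.unop, fun h ↦ h.op⟩
  induction n generalizing X with
  | zero =>
    rw [zero_add, ← projective_iff_hasProjectiveDimensionLT_one,
      ← injective_iff_hasInjectiveDimensionLT_one]
    exact ⟨fun _ ↦ inferInstanceAs (Projective (op X).unop), fun _ ↦ inferInstance⟩
  | succ n hn =>
    have hS := shortExact_kernel (Projective.π X)
    exact (hS.op.hasInjectiveDimensionLT_X₃_iff n
      (inferInstanceAs (Injective (op (Projective.over X))))).symm.trans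
      (hn.trans (hS.hasProjectiveDimensionLT_X₃_iff n
        (inferInstanceAs (Projective (Projective.over X)))).symm)

variable (C) in
lemma spli_op [EnoughInjectives C] : spli Cᵒᵖ = silp C :=
  Equiv.iSup_congr equivToOpposite.symm fun X ↦ iSup_congr_Prop
    (Injective.projective_iff_injective_op (P := X.unop)) fun _ ↦ by
    simp only [projectiveDimension, injectiveDimension, ← hasProjectiveDimensionLT_op_iff]
    rfl

variable (C) in
lemma silp_op [EnoughProjectives C] : silp Cᵒᵖ = spli C :=
  Equiv.iSup_congr equivToOpposite.symm fun X ↦ iSup_congr_Prop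
    (Injective.injective_iff_projective_op (J := X.unop)) fun _ ↦ by
    simp only [projectiveDimension, injectiveDimension, ← hasInjectiveDimensionLT_op_iff]
    rfl

theorem globalGorensteinInjectiveDim_le_iff [EnoughProjectives C] [EnoughInjectives C] {m : ℕ} :
    globalGorensteinInjectiveDim C ≤ m ↔ spli C ≤ m ∧ silp C ≤ m := by
  rw [← globalGorensteinProjectiveDim_op, globalGorensteinProjectiveDim_le_iff, spli_op, silp_op,
    and_comm]

lemma silp_le_spli [EnoughInjectives C] [EnoughProjectives C] {m : ℕ} (h : silp C ≤ m) :
    silp C ≤ spli C := by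
  rw [← spli_op C, ← silp_op C]
  exact spli_le_silp ((spli_op C).trans_le h)

lemma spli_le_and_silp_le_iff [EnoughInjectives C] [EnoughProjectives C] {m : ℕ} :
    spli C ≤ m ∧ silp C ≤ m ↔ spli C = silp C ∧ silp C ≤ m :=
  ⟨fun ⟨h, h'⟩ ↦ ⟨(spli_le_silp h).antisymm (silp_le_spli h'), h'⟩,
    fun ⟨h, h'⟩ ↦ ⟨h.trans_le h', h'⟩⟩

end Duality

end Gorenstein

theorem mainTheorem4 (R : Type u) [Ring R] [Small.{v} R] :
    (∀ m : ℕ, List.TFAE [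
      Gorenstein.globalGorensteinProjectiveDim (ModuleCat.{v} R) ≤ (m : ℕ∞),
      Gorenstein.globalGorensteinInjectiveDim (ModuleCat.{v} R) ≤ (m : ℕ∞),
      Gorenstein.spli (ModuleCat.{v} R) = Gorenstein.silp (ModuleCat.{v} R) ∧
        Gorenstein.silp (ModuleCat.{v} R) ≤ (m : WithBot ℕ∞)]) ∧
    Gorenstein.globalGorensteinProjectiveDim (ModuleCat.{v} R) =
      Gorenstein.globalGorensteinInjectiveDim (ModuleCat.{v} R) := by
  have h (m : ℕ) := Gorenstein.globalGorensteinProjectiveDim_le_iff (C := ModuleCat.{v} R) (m := m)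
  have h' (m : ℕ) := Gorenstein.globalGorensteinInjectiveDim_le_iff (C := ModuleCat.{v} R) (m := m)
  refine ⟨fun m ↦ ?_, Gorenstein.eq_of_forall_le_natCast_iff fun m ↦ (h m).trans (h' m).symm⟩
  tfae_have 1 ↔ 3 := (h m).trans Gorenstein.spli_le_and_silp_le_iff
  tfae_have 2 ↔ 3 := (h' m).trans Gorenstein.spli_le_and_silp_le_iff
  tfae_finish
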